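/- All rings are commutative with unit. Let $R\subseteq S$ be a ring extension, and let $[R,S]$ be the poset, ordered by inclusion, of the $R$-subalgebras of $S$. The extension $R\subseteq S$ is called Prüfer if $R\to T$ is a flat epimorphism of rings for every $T\in[R,S]$. The Prüfer hull $\widetilde R^{S}$ of $R$ in $S$ is the greatest $T\in[R,S]$ such that $R\subseteq T$ is Prüfer. The extension has FCP if every chain in $[R,S]$ is finite. For a ring $A$, the Nagata ring $A(X)$ is the localization of the polynomial ring $A[X]$ at the multiplicatively closed set of the polynomials whose coefficients generate the unit ideal of $A$; the inclusion $R\subseteq S$ induces an extension $R(X)\subseteq S(X)$ that fixes $X$, and for $T\in[R,S]$ the ring $T(X)$ is identified with its image in $S(X)$. **Proposition.** If $R\subseteq S$ has FCP, then the Prüfer hulls of $R$ in $S$ and of $R(X)$ in $S(X)$ exist, and $$\widetilde{R(X)}^{\,S(X)}=\widetilde R^{\,S}(X).$$ -/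

import Mathlib

open Polynomial

/-- The ring extension `R ⊆ S` is Prüfer: for every intermediate ring `T ∈ [R, S]` the inclusion
`R → T` is a flat epimorphism of rings. -/
def IsPruferExtension (R S : Type*) [CommRing R] [CommRing S] [Algebra R S] : Prop :=
  ∀ T : Subalgebra R S, Module.Flat R T ∧ Algebra.IsEpi R T

/-- The extension `R ⊆ S` has FCP: every chain in the poset `[R, S]` of the `R`-subalgebras of `S`
is finite. -/
def HasFCP (R S : Type*) [CommRing R] [CommRing S] [Algebra R S] : Prop :=
  ∀ c : Set (Subalgebra R S), IsChain (· ≤ ·) c → c.Finite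

/-- `T` is the greatest element of `[R, S]` such that `R ⊆ T` is Prüfer. -/
def IsPruferHull (R S : Type*) [CommRing R] [CommRing S] [Algebra R S]
    (T : Subalgebra R S) : Prop :=
  IsGreatest {U : Subalgebra R S | IsPruferExtension R U} T

/-- The Prüfer hull of `R` in `S`: the supremum in `[R, S]` of all `U` such that `R ⊆ U` is Prüfer.
As soon as there is a greatest such `U`, it is this one (see `IsPruferHull.eq_pruferHull`). -/
def pruferHull (R S : Type*) [CommRing R] [CommRing S] [Algebra R S] : Subalgebra R S :=
  sSup {U : Subalgebra R S | IsPruferExtension R U}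

theorem IsPruferHull.eq_pruferHull {R S : Type*} [CommRing R] [CommRing S] [Algebra R S]
    {T : Subalgebra R S} (hT : IsPruferHull R S T) : T = pruferHull R S :=
  hT.isLUB.sSup_eq.symm

/-- The multiplicatively closed set of the polynomials over `R` whose content is the unit ideal. -/
def nagataSubmonoid (R : Type*) [CommRing R] : Submonoid R[X] where
  carrier := {p | p.contentIdeal = ⊤}
  one_mem' := contentIdeal_one
  mul_mem' := fun hp hq => contentIdeal_mul_eq_top_of_contentIdeal_eq_top hp hq

/-- The Nagata ring `R(X)`, the localization of `R[X]` at the polynomials of unit content. -/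
abbrev Nagata (R : Type*) [CommRing R] : Type _ :=
  Localization (nagataSubmonoid R)

theorem nagataSubmonoid_le_comap (R S : Type*) [CommRing R] [CommRing S] [Algebra R S] :
    nagataSubmonoid R ≤ (nagataSubmonoid S).comap (mapRingHom (algebraMap R S)) := by
  intro p hp
  change (p.map (algebraMap R S)).contentIdeal = ⊤
  have hp' : p.contentIdeal = ⊤ := hp
  rw [contentIdeal_map_eq_map_contentIdeal, hp', Ideal.map_top]

/-- The ring homomorphism `R(X) → S(X)` that is induced by `R → S` and fixes `X`. -/
noncomputable def nagataMap (R S : Type*) [CommRing R] [CommRing S] [Algebra R S] :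
    Nagata R →+* Nagata S :=
  IsLocalization.map (Nagata S) (mapRingHom (algebraMap R S)) (nagataSubmonoid_le_comap R S)

noncomputable instance nagataAlgebra (R S : Type*) [CommRing R] [CommRing S] [Algebra R S] :
    Algebra (Nagata R) (Nagata S) :=
  (nagataMap R S).toAlgebra

theorem nagataMap_comp (R T S : Type*) [CommRing R] [CommRing T] [CommRing S] [Algebra R T]
    [Algebra T S] [Algebra R S] [IsScalarTower R T S] :
    (nagataMap T S).comp (nagataMap R T) = nagataMap R S := by
  apply IsLocalization.ringHom_ext (nagataSubmonoid R)
  ext x <;> simp [nagataMap, IsLocalization.map_eq, ← IsScalarTower.algebraMap_apply]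

theorem mem_nonZeroDivisors_of_mem_nagataSubmonoid {R : Type*} [CommRing R] {p : R[X]}
    (hp : p ∈ nagataSubmonoid R) : p ∈ nonZeroDivisors R[X] := by
  rw [Polynomial.mem_nonZeroDivisors_iff]
  intro a ha
  have hle : p.contentIdeal ≤ LinearMap.ker (LinearMap.mulLeft R a) := by
    rw [contentIdeal_def, Ideal.span_le]
    intro c hc
    obtain ⟨n, -, rfl⟩ := mem_coeffs_iff.1 (Finset.mem_coe.1 hc)
    simpa using congrArg (fun q : R[X] => q.coeff n) ha
  have hp' : p.contentIdeal = ⊤ := hp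
  rw [hp'] at hle
  simpa using hle (Submodule.mem_top (x := (1 : R)))

/-- A ring extension `R ⊆ S` induces a ring extension `R(X) ⊆ S(X)`. -/
theorem nagataMap_injective (R S : Type*) [CommRing R] [CommRing S] [Algebra R S]
    (h : Function.Injective (algebraMap R S)) : Function.Injective (nagataMap R S) := by
  rw [injective_iff_map_eq_zero]
  intro x hx
  obtain ⟨p, s, rfl⟩ := IsLocalization.exists_mk'_eq (nagataSubmonoid R) x
  rw [nagataMap, IsLocalization.map_mk', IsLocalization.mk'_eq_zero_iff] at hx
  obtain ⟨m, hm⟩ := hx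
  have h0 : mapRingHom (algebraMap R S) p = 0 :=
    (mem_nonZeroDivisors_of_mem_nagataSubmonoid m.2).1 _ hm
  have hp : p = 0 := map_injective _ h (by simpa using h0)
  rw [hp, IsLocalization.mk'_zero]

/-- For `T ∈ [R, S]`, the Nagata ring `T(X)` as an element of `[R(X), S(X)]`, that is, the image of
the homomorphism `T(X) → S(X)`, which is injective by `nagataMap_injective`. -/
noncomputable def nagataSubalgebra {R S : Type*} [CommRing R] [CommRing S] [Algebra R S]
    (T : Subalgebra R S) : Subalgebra (Nagata R) (Nagata S) where
  toSubsemiring := (nagataMap T S).rangeS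
  algebraMap_mem' := fun r =>
    ⟨nagataMap R T r, RingHom.congr_fun (nagataMap_comp R T S) r⟩

/-! An extension R ⊆ S is Prüfer iff (R : x) + (R : x)x = R for every x in S
(`isPruferExtension_iff`); locally at m this says that x, or an inverse of x, lies in R. Hence two
Prüfer subextensions are comparable locally, their join is Prüfer, and the hull is a directed union.

The inclusion ⊇: finitely many elements generating the unit ideal can be scaled into R so that not
all land in m. Applied to coefficients, this carries the Prüfer property from R ⊆ T to R(X) ⊆ T(X)
(`isPruferElt_nagata`).

The inclusion ⊆: FCP enters through the descending chain condition, which makes S Prüfer over the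
integral closure of R (`isPruferElt_integralClosure`). Call m bad if R is not integrally closed in S
locally at m, and let H (`integrallyClosedHull`) consist of the elements lying in R locally at all
bad m. Then H is Prüfer over R. Now let U be Prüfer over R(X). At a bad m some integral x outside R
satisfies m x ⊆ R locally; as R(X) is integrally closed in U, this forces U into R(X) locally at
m(X) (`le_localSaturation_nagataIdeal`). Any u in U is f/p with p over R of unit content, and
Gauss's lemma puts the coefficients of f in H. So U ⊆ H(X), which lies in the Nagata ring of the
hull. -/

/-- The ideal of all `a` in `R` with `a • x` in the image of `R`. -/
def denominatorIdeal (R : Type*) {S : Type*} [CommRing R] [CommRing S] [Algebra R S] (x : S) :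
    Ideal R :=
  (1 : Submodule R S).comap (LinearMap.toSpanSingleton R S x)

theorem mem_denominatorIdeal {R S : Type*} [CommRing R] [CommRing S] [Algebra R S] {x : S}
    {a : R} : a ∈ denominatorIdeal R x ↔ ∃ r, algebraMap R S r = a • x := by
  simp [denominatorIdeal, Submodule.mem_one]

/-- The condition `(R : x) + (R : x) x = R`, which holds for all `x` in a Prüfer extension. -/
def IsPruferElt (R : Type*) {S : Type*} [CommRing R] [CommRing S] [Algebra R S] (x : S) : Prop :=
  ∃ a b r : R, a • x = algebraMap R S r ∧ b • x = algebraMap R S (1 - a)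

/-- Locally at `m`, the element `x` lies in `R` or has an inverse in `R`. -/
def IsPruferEltAt {R S : Type*} [CommRing R] [CommRing S] [Algebra R S] (m : Ideal R) (x : S) :
    Prop :=
  (∃ t : R, t ∉ m ∧ ∃ r : R, t • x = algebraMap R S r) ∨
    ∃ r t : R, t ∉ m ∧ r • x = algebraMap R S t

/-! ### Denominator ideals, flat epimorphisms and integral elements. -/

section Elements

variable {R S : Type*} [CommRing R] [CommRing S] [Algebra R S]

theorem IsPruferElt.isPruferEltAt {x : S} (hx : IsPruferElt R x) {m : Ideal R} (hm : m ≠ ⊤) :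
    IsPruferEltAt m x := by
  obtain ⟨a, b, r, h1, h2⟩ := hx
  by_cases ha : a ∈ m
  · exact Or.inr ⟨b, 1 - a,
      fun h => hm ((Ideal.eq_top_iff_one _).2 (by simpa using m.add_mem ha h)), h2⟩
  · exact Or.inl ⟨a, ha, r, h1⟩

/-- The two local alternatives say that `m` does not contain (R : x), or does not contain the
preimage of R x in R. So no maximal ideal contains the sum of these two ideals. -/
theorem isPruferElt_of_forall_isMaximal {x : S}
    (hx : ∀ m : Ideal R, m.IsMaximal → IsPruferEltAt m x) : IsPruferElt R x := by
  have key : denominatorIdeal R x ⊔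
      (Submodule.span R {x}).comap (Algebra.linearMap R S) = ⊤ := by
    by_contra hne
    obtain ⟨m, hm, hle⟩ := Ideal.exists_le_maximal _ hne
    obtain ⟨t, ht, r, h⟩ | ⟨r, t, ht, h⟩ := hx m hm
    · exact ht (hle (Submodule.mem_sup_left (mem_denominatorIdeal.2 ⟨r, h.symm⟩)))
    · refine ht (hle (Submodule.mem_sup_right ?_))
      rw [Submodule.mem_comap, Submodule.mem_span_singleton]
      exact ⟨r, h⟩
  obtain ⟨a, ha, c, hc, hac⟩ := Submodule.mem_sup.1 (key ▸ Submodule.mem_top (x := (1 : R)))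
  obtain ⟨r, hr⟩ := mem_denominatorIdeal.1 ha
  rw [Submodule.mem_comap, Submodule.mem_span_singleton] at hc
  obtain ⟨b, hb⟩ := hc
  exact ⟨a, b, r, hr.symm, by rw [hb, ← hac]; simp⟩

theorem isPruferElt_algebraMap (r : R) : IsPruferElt R (algebraMap R S r) :=
  ⟨1, 0, r, by simp, by simp⟩

theorem IsPruferElt.map {T : Type*} [CommRing T] [Algebra R T] (f : S →ₐ[R] T) {x : S}
    (hx : IsPruferElt R x) : IsPruferElt R (f x) := by
  obtain ⟨a, b, r, h1, h2⟩ := hx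
  exact ⟨a, b, r, by rw [← map_smul, h1, f.commutes], by rw [← map_smul, h2, f.commutes]⟩

theorem isPruferElt_map_iff {T : Type*} [CommRing T] [Algebra R T] {f : S →ₐ[R] T}
    (hf : Function.Injective f) {x : S} : IsPruferElt R (f x) ↔ IsPruferElt R x := by
  refine ⟨fun ⟨a, b, r, h1, h2⟩ => ⟨a, b, r, hf ?_, hf ?_⟩, fun h => h.map f⟩
  · rw [map_smul, h1, f.commutes]
  · rw [map_smul, h2, f.commutes]

theorem IsPruferElt.map_denominatorIdeal {x : S} (hx : IsPruferElt R x) :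
    (denominatorIdeal R x).map (algebraMap R S) = ⊤ := by
  obtain ⟨a, b, r, h1, h2⟩ := hx
  rw [Ideal.eq_top_iff_one]
  have ha : a ∈ denominatorIdeal R x := mem_denominatorIdeal.2 ⟨r, h1.symm⟩
  have hb : b ∈ denominatorIdeal R x := mem_denominatorIdeal.2 ⟨_, h2.symm⟩
  have : (1 : S) = algebraMap R S a + x * algebraMap R S b := by
    rw [mul_comm, ← Algebra.smul_def, h2, map_sub, map_one]; ring
  rw [this]
  exact add_mem (Ideal.mem_map_of_mem _ ha) (Ideal.mul_mem_left _ _ (Ideal.mem_map_of_mem _ hb))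

open TensorProduct in
theorem isEpi_of_forall_isPruferElt (h : ∀ x : S, IsPruferElt R x) : Algebra.IsEpi R S := by
  rw [Algebra.isEpi_iff_forall_one_tmul_eq]
  intro t
  obtain ⟨a, b, r, h1, h2⟩ := h t
  have e : (1 : S) = a • (1 : S) + b • t := by
    rw [h2, map_sub, map_one, Algebra.smul_def, mul_one]; ring
  have h1' : a • t = r • (1 : S) := by rw [h1, Algebra.smul_def, mul_one]
  have h2' : b • t = (1 - a) • (1 : S) := by rw [h2, Algebra.smul_def, mul_one]
  calc (1 : S) ⊗ₜ[R] t = (a • (1 : S) + b • t) ⊗ₜ[R] t := by rw [← e]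
    _ = (1 : S) ⊗ₜ[R] (a • t) + (b • t) ⊗ₜ[R] t := by rw [add_tmul, smul_tmul]
    _ = (a • t) ⊗ₜ[R] (1 : S) + t ⊗ₜ[R] (b • t) := by
      rw [h1', ← smul_tmul, smul_tmul b t t]
    _ = t ⊗ₜ[R] (a • (1 : S) + b • t) := by rw [tmul_add, smul_tmul]
    _ = t ⊗ₜ[R] (1 : S) := by rw [← e]

open TensorProduct in
-- For z in the kernel of S ⊗ I → S, the scalars a with a z = 1 ⊗ i generate the unit ideal of S.
-- Each of them kills z, because i maps to 0 in S and R → S is injective.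
theorem flat_of_map_denominatorIdeal_eq_top (hinj : Function.Injective (algebraMap R S))
    (h : ∀ x : S, (denominatorIdeal R x).map (algebraMap R S) = ⊤) : Module.Flat R S := by
  rw [Module.Flat.iff_lTensor_injective']
  intro I
  have key : ∀ z : S ⊗[R] I, Ideal.map (algebraMap R S)
      ((LinearMap.range (TensorProduct.mk R S I 1)).comap
        (LinearMap.toSpanSingleton R _ z)) = ⊤ := by
    intro z
    induction z with
    | zero => rw [LinearMap.toSpanSingleton_zero, Submodule.comap_zero]; exact Ideal.map_top _
    | tmul x i =>
      rw [eq_top_iff, ← h x]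
      refine Ideal.map_mono fun a ha => ?_
      obtain ⟨r, hr⟩ := mem_denominatorIdeal.1 ha
      refine ⟨r • i, ?_⟩
      rw [TensorProduct.mk_apply, LinearMap.toSpanSingleton_apply, TensorProduct.smul_tmul', ← hr,
        ← smul_tmul, Algebra.smul_def, mul_one]
    | add z w hz hw =>
      -- The product of the ideals found for `z` and `w` works for `z + w`, and it still generates
      -- the unit ideal.
      rw [eq_top_iff, ← Ideal.mul_top (⊤ : Ideal S)]
      nth_rw 1 [← hz, ← hw]
      rw [← Ideal.map_mul]
      refine Ideal.map_mono (Ideal.mul_le_inf.trans fun a ha => ?_)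
      have h1 := ha.1
      have h2 := ha.2
      simp only [SetLike.mem_coe, Submodule.mem_comap, LinearMap.toSpanSingleton_apply] at h1 h2 ⊢
      rw [smul_add]
      exact add_mem h1 h2
  rw [injective_iff_map_eq_zero]
  intro z hz
  have hle : Ideal.map (algebraMap R S) ((LinearMap.range (TensorProduct.mk R S I 1)).comap
      (LinearMap.toSpanSingleton R _ z)) ≤
      LinearMap.ker (LinearMap.toSpanSingleton S (S ⊗[R] I) z) := by
    rw [Ideal.map_le_iff_le_comap]
    rintro a ⟨i, hi⟩
    rw [TensorProduct.mk_apply, LinearMap.toSpanSingleton_apply] at hi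
    have h0 : LinearMap.lTensor S I.subtype (a • z) = 0 := by rw [map_smul, hz, smul_zero]
    rw [← hi, LinearMap.lTensor_tmul] at h0
    have h1 := congrArg (TensorProduct.rid R S) h0
    rw [map_zero, TensorProduct.rid_tmul, Algebra.smul_def, mul_one] at h1
    have h2 : i = 0 := Subtype.ext (hinj (by simpa using h1))
    rw [Ideal.mem_comap, LinearMap.mem_ker, LinearMap.toSpanSingleton_apply, algebraMap_smul,
      ← hi, h2, tmul_zero]
  rw [key z] at hle
  simpa using hle (Submodule.mem_top (x := (1 : S)))

open TensorProduct in
-- Tensor the exact sequence (R : x) → R → S/R, 1 ↦ x, with the flat module S. Since 1 ⊗ x = x ⊗ 1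
-- in S ⊗ S, the element 1 ⊗ 1 dies in S ⊗ S/R, so it comes from S ⊗ (R : x).
theorem map_denominatorIdeal_eq_top_of_flat_of_isEpi [Module.Flat R S] [Algebra.IsEpi R S]
    (x : S) : (denominatorIdeal R x).map (algebraMap R S) = ⊤ := by
  have hepi := (Algebra.isEpi_iff_forall_one_tmul_eq R S).1 inferInstance
  let f : R →ₗ[R] S ⧸ (1 : Submodule R S) :=
    (1 : Submodule R S).mkQ ∘ₗ LinearMap.toSpanSingleton R S x
  have hker : LinearMap.ker f = denominatorIdeal R x := by
    rw [LinearMap.ker_comp, Submodule.ker_mkQ]; rfl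
  have hex := Module.Flat.lTensor_exact S (LinearMap.exact_subtype_ker_map f)
  have h0 : LinearMap.lTensor S f ((1 : S) ⊗ₜ[R] (1 : R)) = 0 := by
    have h1 : f 1 = (1 : Submodule R S).mkQ x := by simp [f]
    rw [LinearMap.lTensor_tmul, h1]
    have h2 := congrArg (LinearMap.lTensor S (1 : Submodule R S).mkQ) (hepi x)
    rw [LinearMap.lTensor_tmul, LinearMap.lTensor_tmul] at h2
    have h3 : (1 : Submodule R S).mkQ 1 = 0 :=
      (Submodule.Quotient.mk_eq_zero _).2 (Submodule.one_le.1 le_rfl)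
    rw [h2, h3, tmul_zero]
  obtain ⟨y, hy⟩ := (hex _).1 h0
  have hmem : ∀ y : S ⊗[R] (LinearMap.ker f),
      TensorProduct.rid R S (LinearMap.lTensor S (LinearMap.ker f).subtype y) ∈
        (denominatorIdeal R x).map (algebraMap R S) := by
    intro y
    induction y with
    | zero => simp
    | tmul s k =>
      rw [LinearMap.lTensor_tmul, TensorProduct.rid_tmul, Algebra.smul_def]
      exact Ideal.mul_mem_right _ _ (Ideal.mem_map_of_mem _ (hker ▸ k.2))
    | add y z hy hz => rw [map_add, map_add]; exact add_mem hy hz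
  have := hmem y
  rw [hy, TensorProduct.rid_tmul, one_smul] at this
  exact (Ideal.eq_top_iff_one _).2 this

/-- Lying over: an integral element with `(R : x) R[x] = R[x]` lies in `R`. -/
theorem mem_range_of_isIntegral_of_map_denominatorIdeal_eq_top [Algebra.IsIntegral R S]
    (hinj : Function.Injective (algebraMap R S)) {x : S}
    (h : (denominatorIdeal R x).map (algebraMap R S) = ⊤) : ∃ r, algebraMap R S r = x := by
  rw [Ideal.map_eq_top_iff (algebraMap R S) hinj (algebraMap_isIntegral_iff.2 inferInstance),
    Ideal.eq_top_iff_one] at h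
  simpa using mem_denominatorIdeal.1 h

theorem IsPruferExtension.map_denominatorIdeal_adjoin (h : IsPruferExtension R S) (x : S) :
    (denominatorIdeal R (⟨x, Algebra.self_mem_adjoin_singleton R x⟩ : Algebra.adjoin R {x})).map
      (algebraMap R (Algebra.adjoin R {x})) = ⊤ := by
  have := (h (Algebra.adjoin R {x})).1
  have := (h (Algebra.adjoin R {x})).2
  exact map_denominatorIdeal_eq_top_of_flat_of_isEpi _

theorem IsPruferExtension.mem_range_of_isIntegral (h : IsPruferExtension R S)
    (hinj : Function.Injective (algebraMap R S)) {x : S} (hx : IsIntegral R x) :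
    ∃ r, algebraMap R S r = x := by
  have : Algebra.IsIntegral R (Algebra.adjoin R {x}) := Algebra.IsIntegral.adjoin (by simpa)
  obtain ⟨r, hr⟩ := mem_range_of_isIntegral_of_map_denominatorIdeal_eq_top
    (fun a b hab => hinj (congrArg Subtype.val hab)) (h.map_denominatorIdeal_adjoin x)
  exact ⟨r, congrArg Subtype.val hr⟩

/-- If `R` is integrally closed in `S` and `x` is a root of a polynomial over `R`, then the
coefficients of the polynomial are combinations `d - c x` with `c`, `d` in the denominator
ideal. -/
theorem coeff_eq_of_aeval_eq_zero (hic : ∀ y : S, IsIntegral R y → ∃ r, algebraMap R S r = y)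
    {x : S} (n : ℕ) (p : R[X]) (hn : p.natDegree ≤ n) (hp : aeval x p = 0) (i : ℕ) :
    ∃ c ∈ denominatorIdeal R x, ∃ d, (i ≠ 0 → d ∈ denominatorIdeal R x) ∧
      (i = 0 → d = 0) ∧ algebraMap R S (p.coeff i) = algebraMap R S d - c • x := by
  induction n generalizing p i with
  | zero =>
    rw [Polynomial.eq_C_of_natDegree_le_zero hn] at hp ⊢
    rw [aeval_C] at hp
    refine ⟨0, zero_mem _, 0, fun _ => zero_mem _, fun _ => rfl, ?_⟩
    rw [coeff_C]
    split_ifs <;> simp [hp]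
  | succ n ih =>
    have hint : IsIntegral R (p.coeff (n + 1) • x) := by
      rcases hn.lt_or_eq with h | h
      · rw [coeff_eq_zero_of_natDegree_lt h, zero_smul]; exact isIntegral_zero
      · rw [← h]; exact isIntegral_leadingCoeff_smul p x hp
    obtain ⟨r, hr⟩ := hic _ hint
    have hmem : p.coeff (n + 1) ∈ denominatorIdeal R x := mem_denominatorIdeal.2 ⟨r, hr⟩
    -- The leading coefficient times x is integral, hence equal to some r in R. Rewriting the top
    -- term as r xⁿ lowers the degree and keeps the root.
    set q : R[X] := p.erase (n + 1) + monomial n r with hq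
    have hqdeg : q.natDegree ≤ n := by
      refine natDegree_add_le_of_degree_le ?_ (natDegree_monomial_le _)
      rw [natDegree_le_iff_coeff_eq_zero]
      intro k hk
      rw [coeff_erase]
      split_ifs with h
      · rfl
      · exact coeff_eq_zero_of_natDegree_lt (by omega)
    have hqx : aeval x q = 0 := by
      rw [hq, map_add, aeval_monomial, hr, smul_mul_assoc, ← pow_succ', ← hp]
      conv_rhs => rw [← monomial_add_erase p (n + 1), map_add, aeval_monomial]
      rw [Algebra.smul_def]; ring
    obtain ⟨c, hc, d, hd, hd0, hcd⟩ := ih q hqdeg hqx i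
    by_cases h1 : i = n + 1
    · subst h1
      have := coeff_eq_zero_of_natDegree_lt (show q.natDegree < n + 1 by omega)
      exact ⟨0, zero_mem _, p.coeff (n + 1), fun _ => hmem, by simp, by simp⟩
    · by_cases h2 : i = n
      · subst h2
        refine ⟨c + p.coeff (i + 1), add_mem hc hmem, d, hd, hd0, ?_⟩
        have : q.coeff i = p.coeff i + r := by
          rw [hq, coeff_add, coeff_erase, if_neg h1, coeff_monomial, if_pos rfl]
        rw [this, map_add, hr] at hcd
        rw [add_smul, ← sub_sub, ← hcd]; ring
      · refine ⟨c, hc, d, hd, hd0, ?_⟩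
        rw [← hcd, hq, coeff_add, coeff_erase, if_neg h1, coeff_monomial, if_neg (Ne.symm h2),
          add_zero]

end Elements

/-! ### The elementwise criterion and the existence of the hull. -/

section Criterion

variable {R S : Type*} [CommRing R] [CommRing S] [Algebra R S]

theorem denominatorIdeal_map_of_injective {T : Type*} [CommRing T] [Algebra R T] {f : S →ₐ[R] T}
    (hf : Function.Injective f) (x : S) : denominatorIdeal R (f x) = denominatorIdeal R x := by
  ext a
  simp only [mem_denominatorIdeal, ← f.commutes, ← map_smul, hf.eq_iff]

theorem exists_aeval_eq_of_mem_map {I : Ideal R} {x : S} {y : Algebra.adjoin R {x}}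
    (hy : y ∈ I.map (algebraMap R (Algebra.adjoin R {x}))) :
    ∃ p : R[X], (∀ i, p.coeff i ∈ I) ∧ aeval x p = y := by
  refine Submodule.span_induction ?_ ⟨0, by simp⟩ ?_ ?_ hy
  · rintro _ ⟨a, ha, rfl⟩
    refine ⟨C a, fun i => ?_, by simp⟩
    rw [coeff_C]; split_ifs
    exacts [ha, zero_mem _]
  · rintro y z - - ⟨p, hp, hpy⟩ ⟨q, hq, hqz⟩
    exact ⟨p + q, fun i => by rw [coeff_add]; exact add_mem (hp i) (hq i), by simp [hpy, hqz]⟩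
  · rintro ⟨a, ha⟩ y - ⟨p, hp, hpy⟩
    obtain ⟨q, rfl⟩ := Algebra.adjoin_singleton_eq_range_aeval R x ▸ ha
    refine ⟨q * p, fun i => ?_, by simp [hpy]⟩
    rw [coeff_mul]
    exact sum_mem fun k _ => I.mul_mem_left _ (hp _)

/-- Since (R : x) R[x] = R[x], some p with coefficients in (R : x) has p(x) = 1. The constant
coefficient of p - 1 is then -c x with c in (R : x), so p₀ + c x = 1. -/
theorem IsPruferExtension.isPruferElt (h : IsPruferExtension R S)
    (hinj : Function.Injective (algebraMap R S)) (x : S) : IsPruferElt R x := by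
  have hic : ∀ y : S, IsIntegral R y → ∃ r, algebraMap R S r = y :=
    fun y hy => h.mem_range_of_isIntegral hinj hy
  have h1 := h.map_denominatorIdeal_adjoin x
  rw [Ideal.eq_top_iff_one] at h1
  obtain ⟨p, hp, hpx⟩ := exists_aeval_eq_of_mem_map h1
  rw [← denominatorIdeal_map_of_injective (f := (Algebra.adjoin R {x}).val)
    Subtype.val_injective] at hp
  have hp' : ∀ i, p.coeff i ∈ denominatorIdeal R x := hp
  have hq : aeval x (p - 1) = 0 := by rw [map_sub, hpx]; simp
  obtain ⟨c, hc, d, -, hd, hcd⟩ := coeff_eq_of_aeval_eq_zero hic _ (p - 1) le_rfl hq 0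
  rw [hd rfl] at hcd
  obtain ⟨r, hr⟩ := mem_denominatorIdeal.1 (hp' 0)
  refine ⟨p.coeff 0, c, r, hr.symm, ?_⟩
  have e : (p - 1).coeff 0 = p.coeff 0 - 1 := by simp
  rw [e, map_zero, zero_sub] at hcd
  rw [← neg_eq_iff_eq_neg.2 hcd]
  simp

theorem isPruferExtension_iff (hinj : Function.Injective (algebraMap R S)) :
    IsPruferExtension R S ↔ ∀ x : S, IsPruferElt R x := by
  refine ⟨fun h => h.isPruferElt hinj, fun h T => ?_⟩
  have hT : ∀ x : T, IsPruferElt R x :=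
    fun x => (isPruferElt_map_iff (f := T.val) Subtype.val_injective).1 (h x)
  exact ⟨flat_of_map_denominatorIdeal_eq_top (fun a b hab => hinj (congrArg Subtype.val hab))
    fun x => (hT x).map_denominatorIdeal, isEpi_of_forall_isPruferElt hT⟩

theorem isPruferExtension_subalgebra_iff (hinj : Function.Injective (algebraMap R S))
    (U : Subalgebra R S) : IsPruferExtension R U ↔ ∀ x ∈ U, IsPruferElt R x := by
  rw [isPruferExtension_iff (fun a b hab => hinj (congrArg Subtype.val hab))]
  refine ⟨fun h x hx => (h ⟨x, hx⟩).map U.val, fun h x => ?_⟩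
  exact (isPruferElt_map_iff (f := U.val) Subtype.val_injective).1 (h x x.2)

/-- The elements of `S` that lie in `U` locally at the prime ideal `m`. -/
def localSaturation (U : Subalgebra R S) (m : Ideal R) [m.IsPrime] : Subalgebra R S where
  carrier := {x | ∃ t ∉ m, t • x ∈ U}
  mul_mem' := by
    rintro _ _ ⟨s, hs, hx⟩ ⟨t, ht, hy⟩
    exact ⟨s * t, m.primeCompl.mul_mem hs ht, by rw [← smul_mul_smul_comm]; exact mul_mem hx hy⟩
  add_mem' := by
    rintro x y ⟨s, hs, hx⟩ ⟨t, ht, hy⟩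
    refine ⟨s * t, m.primeCompl.mul_mem hs ht, ?_⟩
    rw [smul_add, mul_comm, mul_smul, mul_comm, mul_smul]
    exact add_mem (U.smul_mem hx _) (U.smul_mem hy _)
  algebraMap_mem' r := ⟨1, m.primeCompl.one_mem, U.smul_mem (U.algebraMap_mem r) _⟩

theorem mem_localSaturation {U : Subalgebra R S} {m : Ideal R} [m.IsPrime] {x : S} :
    x ∈ localSaturation U m ↔ ∃ t ∉ m, t • x ∈ U := Iff.rfl

theorem le_localSaturation (U : Subalgebra R S) (m : Ideal R) [m.IsPrime] :
    U ≤ localSaturation U m :=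
  fun _ hx => ⟨1, m.primeCompl.one_mem, U.smul_mem hx 1⟩

theorem mem_localSaturation_of_smul {U : Subalgebra R S} {m : Ideal R} [m.IsPrime] {x : S}
    {t : R} (ht : t ∉ m) (hx : t • x ∈ localSaturation U m) : x ∈ localSaturation U m := by
  obtain ⟨s, hs, hx⟩ := hx
  exact ⟨s * t, m.primeCompl.mul_mem hs ht, by rwa [mul_smul]⟩

theorem isPruferEltAt_iff {m : Ideal R} [m.IsPrime] {x : S} : IsPruferEltAt m x ↔
    x ∈ localSaturation (⊥ : Subalgebra R S) m ∨ ∃ r t : R, t ∉ m ∧ r • x = algebraMap R S t := by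
  simp only [IsPruferEltAt, mem_localSaturation, Algebra.mem_bot, Set.mem_range, eq_comm]

theorem IsPruferEltAt.of_smul {m : Ideal R} [m.IsPrime] {x : S} {t : R} (ht : t ∉ m)
    (h : IsPruferEltAt m (t • x)) : IsPruferEltAt m x := by
  obtain ⟨s, hs, r, h⟩ | ⟨r, s, hs, h⟩ := h
  · exact Or.inl ⟨s * t, m.primeCompl.mul_mem hs ht, r, by rw [mul_smul, h]⟩
  · exact Or.inr ⟨r * t, s, hs, by rw [mul_smul, h]⟩

/-- Prüfer extensions of `R` in `S` are comparable locally at a prime ideal. -/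
theorem le_localSaturation_or_le_localSaturation {U V : Subalgebra R S}
    (hU : ∀ x ∈ U, IsPruferElt R x) (hV : ∀ x ∈ V, IsPruferElt R x) (m : Ideal R) [hm : m.IsPrime] :
    U ≤ localSaturation V m ∨ V ≤ localSaturation U m := by
  by_contra! hne
  obtain ⟨x, hxU, hxV⟩ := SetLike.not_le_iff_exists.1 hne.1
  obtain ⟨y, hyV, hyU⟩ := SetLike.not_le_iff_exists.1 hne.2
  have hbot : ∀ (W : Subalgebra R S) (z : S), z ∈ localSaturation (⊥ : Subalgebra R S) m →
      z ∈ localSaturation W m := by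
    rintro W z ⟨t, ht, hz⟩
    exact ⟨t, ht, bot_le (a := W) hz⟩
  obtain h | ⟨a, s, hs, ha⟩ := isPruferEltAt_iff.1 ((hU x hxU).isPruferEltAt hm.ne_top)
  · exact hxV (hbot V x h)
  obtain h | ⟨b, t, ht, hb⟩ := isPruferEltAt_iff.1 ((hV y hyV).isPruferEltAt hm.ne_top)
  · exact hyU (hbot U y h)
  -- If b z were not locally in R, some c would have c b z = s outside m. Then s y = c (b y) z = c t
  -- z lies in U, against the choice of y.
  have key : ∀ (U : Subalgebra R S) (_ : ∀ x ∈ U, IsPruferElt R x) (y z : S) (b t : R),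
      t ∉ m → b • y = algebraMap R S t → y ∉ localSaturation U m → z ∈ U →
      b • z ∈ localSaturation (⊥ : Subalgebra R S) m := by
    intro U hU y z b t ht hb hy hz
    obtain h | ⟨c, s, hs, hc⟩ :=
      isPruferEltAt_iff.1 ((hU _ (U.smul_mem hz b)).isPruferEltAt hm.ne_top)
    · exact h
    · refine absurd ⟨s, hs, ?_⟩ hy
      have : s • y = (c * t) • z := by
        rw [Algebra.smul_def s, ← hc, mul_smul, Algebra.smul_def c, Algebra.smul_def b,
          Algebra.smul_def c, Algebra.smul_def t, ← hb, Algebra.smul_def b]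
        ring
      rw [this]
      exact U.smul_mem hz _
  have h1 := key U hU y (x * x) b t ht hb hyU (mul_mem hxU hxU)
  have h2 := key V hV x y a s hs ha hxV hyV
  refine hxV (hbot V x (mem_localSaturation_of_smul (m.primeCompl.mul_mem hs ht) ?_))
  -- Both factors lie locally in R; the square leaves one x over after (a x)(b y) = s t.
  have : (s * t) • x = (a • y) * (b • (x * x)) := by
    rw [Algebra.smul_def, map_mul, ← ha, ← hb]
    simp only [Algebra.smul_def]; ring
  change (s * t) • x ∈ _
  rw [this]
  exact mul_mem h2 h1

/-- Locally at `m` one of the two algebras contains the other, so the join lies locally in the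
larger one. -/
theorem isPruferElt_of_mem_sup {U V : Subalgebra R S}
    (hU : ∀ x ∈ U, IsPruferElt R x) (hV : ∀ x ∈ V, IsPruferElt R x) {x : S} (hx : x ∈ U ⊔ V) :
    IsPruferElt R x := by
  refine isPruferElt_of_forall_isMaximal fun m hm => ?_
  have key : ∀ W : Subalgebra R S, (∀ x ∈ W, IsPruferElt R x) → U ⊔ V ≤ localSaturation W m →
      IsPruferEltAt m x := by
    intro W hW hle
    obtain ⟨t, ht, htx⟩ := hle hx
    exact ((hW _ htx).isPruferEltAt hm.ne_top).of_smul ht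
  obtain h | h := le_localSaturation_or_le_localSaturation hU hV m
  · exact key V hV (sup_le h (le_localSaturation V m))
  · exact key U hU (sup_le (le_localSaturation U m) h)

theorem isPruferHull_pruferHull (hinj : Function.Injective (algebraMap R S)) :
    IsPruferHull R S (pruferHull R S) := by
  refine ⟨?_, fun U hU => le_sSup hU⟩
  rw [Set.mem_ofPred_eq, isPruferExtension_subalgebra_iff hinj]
  intro x hx
  have hne : {U : Subalgebra R S | IsPruferExtension R U}.Nonempty := by
    refine ⟨⊥, (isPruferExtension_subalgebra_iff hinj _).2 fun x hx => ?_⟩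
    obtain ⟨r, rfl⟩ := Algebra.mem_bot.1 hx
    exact isPruferElt_algebraMap r
  have hdir : DirectedOn (· ≤ ·) {U : Subalgebra R S | IsPruferExtension R U} := by
    intro U hU V hV
    rw [Set.mem_ofPred_eq, isPruferExtension_subalgebra_iff hinj] at hU hV
    exact ⟨U ⊔ V, (isPruferExtension_subalgebra_iff hinj _).2
      fun x hx => isPruferElt_of_mem_sup hU hV hx, le_sup_left, le_sup_right⟩
  have := hne.to_subtype
  rw [pruferHull, sSup_eq_iSup', ← SetLike.mem_coe,
    Subalgebra.coe_iSup_of_directed hdir.directed_val, Set.mem_iUnion] at hx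
  obtain ⟨U, hx⟩ := hx
  exact (isPruferExtension_subalgebra_iff hinj U).1 U.2 x hx

end Criterion

/-! ### Contents of polynomials and ideals of the Nagata ring. -/

section Content

variable {R S : Type*} [CommRing R] [CommRing S] [Algebra R S]

theorem contentIdeal_le_iff {p : R[X]} {I : Ideal R} :
    p.contentIdeal ≤ I ↔ ∀ i, p.coeff i ∈ I := by
  refine ⟨fun h i => h (coeff_mem_contentIdeal p i), fun h => ?_⟩
  rw [contentIdeal_def, Ideal.span_le]
  intro c hc
  obtain ⟨n, -, rfl⟩ := mem_coeffs_iff.1 (Finset.mem_coe.1 hc)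
  exact h n

theorem exists_coeff_notMem_of_mem_nagataSubmonoid {p : R[X]} (hp : p ∈ nagataSubmonoid R)
    {m : Ideal R} (hm : m ≠ ⊤) : ∃ i, p.coeff i ∉ m := by
  by_contra! h
  have hp' : p.contentIdeal = ⊤ := hp
  exact hm (top_le_iff.1 (hp' ▸ contentIdeal_le_iff.2 h))

/-- The shift moves `q` beyond the degree of `p`, so no coefficients overlap. -/
theorem sup_contentIdeal_le_contentIdeal (p q : R[X]) :
    p.contentIdeal ⊔ q.contentIdeal ≤ (p + X ^ (p.natDegree + 1) * q).contentIdeal := by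
  refine sup_le (contentIdeal_le_iff.2 fun i => ?_) (contentIdeal_le_iff.2 fun i => ?_)
  · rcases lt_or_ge p.natDegree i with h | h
    · rw [coeff_eq_zero_of_natDegree_lt h]; exact zero_mem _
    · have := coeff_mem_contentIdeal (p + X ^ (p.natDegree + 1) * q) i
      rwa [coeff_add, coeff_X_pow_mul', if_neg (by omega), add_zero] at this
  · have := coeff_mem_contentIdeal (p + X ^ (p.natDegree + 1) * q) (i + (p.natDegree + 1))
    rwa [coeff_add, coeff_X_pow_mul, coeff_eq_zero_of_natDegree_lt (by omega), zero_add] at this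

/-- The sum of the contents of the elements of an ideal of `R[X]`. -/
def Ideal.polynomialContent (A : Ideal R[X]) : Ideal R where
  carrier := {a | ∃ p ∈ A, a ∈ p.contentIdeal}
  zero_mem' := ⟨0, zero_mem _, zero_mem _⟩
  add_mem' := by
    rintro a b ⟨p, hp, ha⟩ ⟨q, hq, hb⟩
    refine ⟨p + X ^ (p.natDegree + 1) * q, add_mem hp (A.mul_mem_left _ hq), ?_⟩
    exact sup_contentIdeal_le_contentIdeal p q
      (add_mem (Submodule.mem_sup_left ha) (Submodule.mem_sup_right hb))
  smul_mem' := by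
    rintro c a ⟨p, hp, ha⟩
    exact ⟨p, hp, Ideal.mul_mem_left _ _ ha⟩

/-- The contents of the elements of `A` form a directed family. If their union is contained in no
maximal ideal, a single content contains 1. -/
theorem exists_mem_nagataSubmonoid (A : Ideal R[X])
    (hA : ∀ m : Ideal R, m.IsMaximal → ∃ p ∈ A, ∃ i, p.coeff i ∉ m) :
    ∃ p ∈ A, p ∈ nagataSubmonoid R := by
  have h : A.polynomialContent = ⊤ := by
    by_contra hne
    obtain ⟨m, hm, hle⟩ := Ideal.exists_le_maximal _ hne
    obtain ⟨p, hp, i, hi⟩ := hA m hm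
    exact hi (hle ⟨p, hp, coeff_mem_contentIdeal p i⟩)
  obtain ⟨p, hp, h1⟩ := (Ideal.eq_top_iff_one _).1 h
  exact ⟨p, hp, (Ideal.eq_top_iff_one _).2 h1⟩

theorem exists_isMaximal_of_isMaximal_nagata (M : Ideal (Nagata R)) (hM : M ≠ ⊤) :
    ∃ m : Ideal R, m.IsMaximal ∧ ∀ p : R[X], algebraMap R[X] (Nagata R) p ∈ M →
      ∀ i, p.coeff i ∈ m := by
  by_contra! h
  obtain ⟨p, hp, hpN⟩ := exists_mem_nagataSubmonoid (M.comap (algebraMap R[X] (Nagata R))) h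
  exact hM (Ideal.eq_top_of_isUnit_mem _ hp (IsLocalization.map_units (Nagata R) ⟨p, hpN⟩))

theorem algebraMap_nagata (p : R[X]) :
    algebraMap (Nagata R) (Nagata S) (algebraMap R[X] (Nagata R) p) =
      algebraMap S[X] (Nagata S) (p.map (algebraMap R S)) :=
  IsLocalization.map_eq (nagataSubmonoid_le_comap R S) p

theorem algebraMap_nagata_injective (R : Type*) [CommRing R] :
    Function.Injective (algebraMap R[X] (Nagata R)) :=
  IsLocalization.injective _ fun _ => mem_nonZeroDivisors_of_mem_nagataSubmonoid

end Content

/-! ### Prüfer extensions pass to Nagata rings. -/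

section PruferNagata

variable {R S : Type*} [CommRing R] [CommRing S] [Algebra R S]

/-- Write 1 as a combination of `F`. If no multiple of an element of `F` were in R outside m, every
summand would lie locally in m, and so would 1. -/
theorem exists_mul_eq_algebraMap_of_span_eq_top (hinj : Function.Injective (algebraMap R S))
    (hS : ∀ x : S, IsPruferElt R x) (m : Ideal R) [hm : m.IsPrime] (F : Finset S)
    (hF : Ideal.span (F : Set S) = ⊤) : ∃ x ∈ F, ∃ w : S, ∃ t ∉ m, w * x = algebraMap R S t := by
  by_contra! h
  obtain ⟨f, -, hf⟩ := Submodule.mem_span_finset.1 ((Ideal.eq_top_iff_one _).1 hF)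
  have key : ∃ t ∉ m, ∃ r ∈ m, t • (∑ x ∈ F, f x • x) = algebraMap R S r := by
    refine Finset.sum_induction (fun x => f x • x)
      (fun z => ∃ t ∉ m, ∃ r ∈ m, t • z = algebraMap R S r) ?_ ?_ ?_
    · rintro x y ⟨s, hs, a, ha, hx⟩ ⟨t, ht, b, hb, hy⟩
      refine ⟨s * t, m.primeCompl.mul_mem hs ht, t * a + s * b,
        add_mem (m.mul_mem_left _ ha) (m.mul_mem_left _ hb), ?_⟩
      rw [map_add, map_mul, map_mul, ← hx, ← hy]
      simp only [Algebra.smul_def, map_mul]; ring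
    · exact ⟨1, m.primeCompl.one_mem, 0, zero_mem _, by simp⟩
    · intro x hx
      obtain ⟨t, ht, r, htr⟩ | ⟨r, t, ht, hr⟩ := (hS (f x • x)).isPruferEltAt hm.ne_top
      · refine ⟨t, ht, r, by_contra fun hr => h x hx (t • f x) r hr ?_, htr⟩
        rw [← htr, smul_eq_mul, smul_mul_assoc]
      · exact absurd (by rw [← hr, smul_eq_mul, smul_mul_assoc]) (h x hx (r • f x) t ht)
  obtain ⟨t, ht, r, hr, htr⟩ := key
  rw [hf, Algebra.smul_def, mul_one] at htr
  exact ht (hinj htr ▸ hr)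

/-- This is division by an element of least value, as for a valuation. When `y` is added, either `w
* y` is locally in R and only a denominator is cleared, or `w * y` is locally inverse to an element
of R and `y` becomes the new least element. -/
theorem exists_smul_mem_range (hS : ∀ x : S, IsPruferElt R x) (m : Ideal R) [hm : m.IsPrime]
    {x₀ w₀ : S} {t₀ : R} (ht₀ : t₀ ∉ m) (h₀ : w₀ * x₀ = algebraMap R S t₀) (F : Finset S) :
    ∃ w : S, (∀ x, x = x₀ ∨ x ∈ F → ∃ r, w * x = algebraMap R S r) ∧
      ∃ x, (x = x₀ ∨ x ∈ F) ∧ ∃ t ∉ m, w * x = algebraMap R S t := by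
  classical
  induction F using Finset.induction_on with
  | empty => exact ⟨w₀, by simp only [Finset.notMem_empty, or_false, forall_eq]; exact ⟨t₀, h₀⟩,
      x₀, Or.inl rfl, t₀, ht₀, h₀⟩
  | insert y F _ ih =>
    obtain ⟨w, hw, x, hx, t, ht, hxt⟩ := ih
    obtain ⟨s, hs, r, hr⟩ | ⟨s, r, hr', hr⟩ := (hS (w * y)).isPruferEltAt hm.ne_top
    · refine ⟨s • w, ?_, x, by simp only [Finset.mem_insert]; tauto, s * t,
        m.primeCompl.mul_mem hs ht, by rw [smul_mul_assoc, hxt, Algebra.smul_def, map_mul]⟩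
      intro z hz
      rw [Finset.mem_insert] at hz
      obtain rfl | hz : z = y ∨ (z = x₀ ∨ z ∈ F) := by tauto
      · exact ⟨r, by rw [smul_mul_assoc, hr]⟩
      · obtain ⟨a, ha⟩ := hw z hz
        exact ⟨s * a, by rw [smul_mul_assoc, ha, Algebra.smul_def, map_mul]⟩
    · refine ⟨s • w, ?_, y, by simp, r, hr', by rw [smul_mul_assoc, hr]⟩
      intro z hz
      rw [Finset.mem_insert] at hz
      obtain rfl | hz : z = y ∨ (z = x₀ ∨ z ∈ F) := by tauto
      · exact ⟨r, by rw [smul_mul_assoc, hr]⟩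
      · obtain ⟨a, ha⟩ := hw z hz
        exact ⟨s * a, by rw [smul_mul_assoc, ha, Algebra.smul_def, map_mul]⟩

theorem exists_map_eq_of_forall_coeff {f : S[X]} (h : ∀ i, ∃ r, f.coeff i = algebraMap R S r) :
    ∃ p : R[X], p.map (algebraMap R S) = f :=
  (mem_lifts f).1 ((lifts_iff_coeff_lifts f).2 fun i => (h i).imp fun _ hr => hr.symm)

/-- In a Prüfer extension, a common multiplier brings two polynomials, one of them of unit content,
into `R[X]` but, locally at `m`, not both into `m[X]`. -/
theorem exists_C_mul_eq_map (hinj : Function.Injective (algebraMap R S))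
    (hS : ∀ x : S, IsPruferElt R x) (m : Ideal R) [hm : m.IsPrime] {s : S[X]}
    (hs : s ∈ nagataSubmonoid S) (f : S[X]) :
    ∃ (w : S) (p q : R[X]), C w * s = p.map (algebraMap R S) ∧ C w * f = q.map (algebraMap R S) ∧
      ((∃ i, p.coeff i ∉ m) ∨ ∃ i, q.coeff i ∉ m) := by
  classical
  obtain ⟨x₀, hx₀, w₀, t₀, ht₀, h₀⟩ :=
    exists_mul_eq_algebraMap_of_span_eq_top hinj hS m s.coeffs hs
  obtain ⟨w, hw, x, hx, t, ht, hxt⟩ :=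
    exists_smul_mem_range hS m ht₀ h₀ (s.coeffs ∪ f.coeffs)
  have hw' : ∀ x ∈ s.coeffs ∪ f.coeffs, ∃ r, w * x = algebraMap R S r :=
    fun x hx => hw x (Or.inr hx)
  have hcoeff : ∀ (g : S[X]), g.coeffs ⊆ s.coeffs ∪ f.coeffs →
      ∃ p : R[X], p.map (algebraMap R S) = C w * g := by
    intro g hg
    refine exists_map_eq_of_forall_coeff fun i => ?_
    rw [coeff_C_mul]
    by_cases h : g.coeff i = 0
    · exact ⟨0, by rw [h, mul_zero, map_zero]⟩
    · exact hw' _ (hg (coeff_mem_coeffs h))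
  obtain ⟨p, hp⟩ := hcoeff s Finset.subset_union_left
  obtain ⟨q, hq⟩ := hcoeff f Finset.subset_union_right
  have hx' : x ∈ s.coeffs ∨ x ∈ f.coeffs := by
    rw [Finset.mem_union] at hx
    rcases hx with rfl | hx
    exacts [Or.inl hx₀, hx]
  have hmem : ∀ (g : S[X]) (p : R[X]), p.map (algebraMap R S) = C w * g → x ∈ g.coeffs →
      ∃ i, p.coeff i ∉ m := by
    intro g p hp hx
    obtain ⟨i, -, rfl⟩ := mem_coeffs_iff.1 hx
    refine ⟨i, ?_⟩
    have := congrArg (fun q => q.coeff i) hp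
    rw [coeff_map, coeff_C_mul, hxt] at this
    rwa [hinj this]
  exact ⟨w, p, q, hp.symm, hq.symm, hx'.imp (hmem s p hp) (hmem f q hq)⟩

/-- For x = f/s the common multiplier gives p x = q in which p or q lies outside m[X], hence outside
`M`. -/
theorem isPruferElt_nagata (hinj : Function.Injective (algebraMap R S))
    (hS : ∀ x : S, IsPruferElt R x) (x : Nagata S) : IsPruferElt (Nagata R) x := by
  refine isPruferElt_of_forall_isMaximal fun M hM => ?_
  obtain ⟨m, hm, hmM⟩ := exists_isMaximal_of_isMaximal_nagata M hM.ne_top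
  obtain ⟨f, s, rfl⟩ := IsLocalization.exists_mk'_eq (nagataSubmonoid S) x
  obtain ⟨w, p, q, hp, hq, h⟩ := exists_C_mul_eq_map hinj hS m s.2 f
  have key : algebraMap R[X] (Nagata R) p • IsLocalization.mk' (Nagata S) f s =
      algebraMap (Nagata R) (Nagata S) (algebraMap R[X] (Nagata R) q) := by
    rw [Algebra.smul_def, algebraMap_nagata, algebraMap_nagata, ← hp, ← hq, map_mul, map_mul,
      mul_assoc, IsLocalization.mk'_spec']
  obtain ⟨i, hi⟩ | ⟨i, hi⟩ := h
  · exact Or.inl ⟨_, fun h => hi (hmM p h i), _, key⟩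
  · exact Or.inr ⟨_, _, fun h => hi (hmM q h i), key⟩

/-- For an intermediate ring `T`, the homomorphism `T(X) → S(X)` over `R(X)`. -/
noncomputable def nagataVal (T : Subalgebra R S) : Nagata T →ₐ[Nagata R] Nagata S where
  __ := nagataMap T S
  commutes' r := RingHom.congr_fun (nagataMap_comp R T S) r

theorem mem_nagataSubalgebra {T : Subalgebra R S} {x : Nagata S} :
    x ∈ nagataSubalgebra T ↔ ∃ y, nagataVal T y = x := Iff.rfl

theorem isPruferExtension_nagataSubalgebra (hinj : Function.Injective (algebraMap R S))
    {T : Subalgebra R S} (hT : IsPruferExtension R T) :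
    IsPruferExtension (Nagata R) (nagataSubalgebra T) := by
  have hinjT : Function.Injective (algebraMap R T) :=
    fun a b hab => hinj (congrArg Subtype.val hab)
  rw [isPruferExtension_subalgebra_iff (nagataMap_injective R S hinj)]
  intro x hx
  obtain ⟨y, rfl⟩ := mem_nagataSubalgebra.1 hx
  exact (isPruferElt_nagata hinjT ((isPruferExtension_iff hinjT).1 hT) y).map _

end PruferNagata

/-! ### Denominators of S(X) can be taken over R. -/

section Denominators

/-- Every polynomial of unit content over `S` divides one of unit content over `R`; this says that
`S(X)` is generated by `S` and `R(X)`. -/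
def HasNagataDenominators (R S : Type*) [CommRing R] [CommRing S] [Algebra R S] : Prop :=
  ∀ s ∈ nagataSubmonoid S, ∃ p ∈ nagataSubmonoid R, s ∣ p.map (algebraMap R S)

theorem HasNagataDenominators.trans {R B S : Type*} [CommRing R] [CommRing B] [CommRing S]
    [Algebra R B] [Algebra B S] [Algebra R S] [IsScalarTower R B S]
    (h1 : HasNagataDenominators R B) (h2 : HasNagataDenominators B S) :
    HasNagataDenominators R S := by
  intro s hs
  obtain ⟨p, hp, hsp⟩ := h2 s hs
  obtain ⟨q, hq, hpq⟩ := h1 p hp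
  refine ⟨q, hq, hsp.trans ?_⟩
  rw [IsScalarTower.algebraMap_eq R B S, ← Polynomial.map_map]
  exact Polynomial.map_dvd _ hpq

variable {R S : Type*} [CommRing R] [CommRing S] [Algebra R S]

theorem hasNagataDenominators_of_forall_isMaximal
    (h : ∀ s ∈ nagataSubmonoid S, ∀ m : Ideal R, m.IsMaximal →
      ∃ p : R[X], s ∣ p.map (algebraMap R S) ∧ ∃ i, p.coeff i ∉ m) :
    HasNagataDenominators R S := by
  intro s hs
  obtain ⟨p, hp, hpN⟩ := exists_mem_nagataSubmonoid
    ((Ideal.span {s}).comap (mapRingHom (algebraMap R S))) fun m hm => by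
      obtain ⟨p, hp, hi⟩ := h s hs m hm
      exact ⟨p, Ideal.mem_comap.2 (Ideal.mem_span_singleton.2 hp), hi⟩
  exact ⟨p, hpN, Ideal.mem_span_singleton.1 (Ideal.mem_comap.1 hp)⟩

theorem hasNagataDenominators_of_forall_isPruferElt (hinj : Function.Injective (algebraMap R S))
    (hS : ∀ x : S, IsPruferElt R x) : HasNagataDenominators R S := by
  refine hasNagataDenominators_of_forall_isMaximal fun s hs m hm => ?_
  -- With second polynomial 0 we get q = 0, so `p` is the one with a coefficient outside m.
  obtain ⟨w, p, q, hp, hq, h⟩ := exists_C_mul_eq_map hinj hS m hs 0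
  rw [mul_zero, eq_comm, Polynomial.map_eq_zero_iff hinj] at hq
  refine ⟨p, ⟨C w, by rw [← hp, mul_comm]⟩, h.resolve_right ?_⟩
  simp [hq]

/-- Otherwise lying over gives a prime Q of S[X] that contains s and lies over m[X]. With n = Q ∩ S,
incomparability for n[X] ⊆ Q yields Q = n[X], which contains no polynomial of unit content. -/
theorem hasNagataDenominators_of_isIntegral [Algebra.IsIntegral R S] :
    HasNagataDenominators R S := by
  refine hasNagataDenominators_of_forall_isMaximal fun s hs m hm => ?_
  by_contra! h
  let : Algebra R[X] S[X] := Polynomial.algebra R S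
  have : Algebra.IsIntegral R[X] S[X] :=
    ⟨fun f => isIntegral_iff_isIntegral_coeff.2 fun _ => Algebra.IsIntegral.isIntegral _⟩
  have hmp : (m.map (C : R →+* R[X])).IsPrime := Ideal.isPrime_map_C_of_isPrime
  obtain ⟨Q, hQ, hQp, hQm⟩ := Ideal.exists_ideal_over_prime_of_isIntegral
    (m.map (C : R →+* R[X])) (Ideal.span {s}) fun p hp =>
      Ideal.mem_map_C_iff.2 fun i => h p (Ideal.mem_span_singleton.1 hp) i
  have hn : (Q.comap (C : S →+* S[X])).IsPrime := Ideal.IsPrime.comap _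
  have hnp : ((Q.comap (C : S →+* S[X])).map (C : S →+* S[X])).IsPrime :=
    Ideal.isPrime_map_C_of_isPrime
  have hle : (Q.comap (C : S →+* S[X])).map (C : S →+* S[X]) ≤ Q := Ideal.map_comap_le
  obtain heq | hlt := hle.eq_or_lt
  · obtain ⟨i, hi⟩ := exists_coeff_notMem_of_mem_nagataSubmonoid hs hn.ne_top
    exact hi (Ideal.mem_map_C_iff.1 (heq.ge (hQ (Ideal.mem_span_singleton_self s))) i)
  · refine absurd (Ideal.IsIntegral.comap_lt_comap (R := R[X]) hlt) (not_lt_of_ge ?_)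
    rw [hQm, Ideal.map_le_iff_le_comap]
    intro a ha
    have : C a ∈ Q.comap (algebraMap R[X] S[X]) := hQm ▸ Ideal.mem_map_of_mem _ ha
    rw [Ideal.mem_comap, Ideal.mem_comap]
    rw [Ideal.mem_comap] at this
    have e : algebraMap R[X] S[X] (C a) = C (algebraMap R S a) := Polynomial.map_C _
    rw [e] at this ⊢
    exact Ideal.mem_map_of_mem _ this

end Denominators

/-! ### Descending chains, Nakayama arguments and Gauss's lemma. -/

section FCP

variable {R S : Type*} [CommRing R] [CommRing S] [Algebra R S]

theorem HasFCP.wellFoundedLT (h : HasFCP R S) : WellFoundedLT (Subalgebra R S) := by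
  refine ⟨RelEmbedding.wellFounded_iff_isEmpty.2 ⟨fun f => ?_⟩⟩
  have hf : ∀ {a b : ℕ}, a < b → f b < f a := fun {a b} hab => f.map_rel_iff.2 hab
  refine Set.infinite_range_of_injective f.injective (h _ ?_)
  rintro _ ⟨a, rfl⟩ _ ⟨b, rfl⟩ hne
  rcases lt_trichotomy a b with hab | rfl | hab
  exacts [Or.inr (hf hab).le, absurd rfl hne, Or.inl (hf hab).le]

/-- If t xⁿ⁺¹ is in R, then t x is integral. If r xⁿ⁺¹ = t, then (r xⁿ)ⁿ⁺¹ = r tⁿ, so r xⁿ is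
integral, hence in R, and its product with x is t. -/
theorem isPruferEltAt_of_pow (hic : ∀ y : S, IsIntegral R y → ∃ r, algebraMap R S r = y)
    {m : Ideal R} [m.IsPrime] {x : S} {n : ℕ} (hx : IsPruferEltAt m (x ^ (n + 1))) :
    IsPruferEltAt m x := by
  obtain ⟨t, ht, r, h⟩ | ⟨r, t, ht, h⟩ := hx
  · have hint : IsIntegral R (t • x) := by
      refine IsIntegral.of_pow n.succ_pos ?_
      rw [_root_.smul_pow, pow_succ, mul_smul, h, Algebra.smul_def, ← map_mul]
      exact isIntegral_algebraMap
    obtain ⟨r', hr'⟩ := hic _ hint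
    exact Or.inl ⟨t, ht, r', hr'.symm⟩
  · have hint : IsIntegral R (r • x ^ n) := by
      refine IsIntegral.of_pow n.succ_pos ?_
      have : (r • x ^ n) ^ (n + 1) = r • (r • x ^ (n + 1)) ^ n := by
        simp only [Algebra.smul_def]; ring
      rw [this, h, Algebra.smul_def, ← map_pow, ← map_mul]
      exact isIntegral_algebraMap
    obtain ⟨r', hr'⟩ := hic _ hint
    exact Or.inr ⟨r', t, ht, by rw [← h, pow_succ, ← smul_mul_assoc, ← hr', Algebra.smul_def]⟩

/-- If y = q(y²), then y is a root of q(X²) - X, whose linear coefficient is -1. So -1 = d - c y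
with c, d in (R : y). -/
theorem isPruferElt_of_mem_adjoin_sq
    (hic : ∀ y : S, IsIntegral R y → ∃ r, algebraMap R S r = y) {y : S}
    (hy : y ∈ Algebra.adjoin R {y ^ 2}) : IsPruferElt R y := by
  rw [Algebra.adjoin_singleton_eq_range_aeval] at hy
  obtain ⟨q, hq⟩ := hy
  have hp : aeval y (expand R 2 q - X) = 0 := by
    rw [map_sub, expand_aeval, aeval_X, sub_eq_zero]; exact hq
  obtain ⟨c, -, d, hd, -, hcd⟩ := coeff_eq_of_aeval_eq_zero hic _ _ le_rfl hp 1
  obtain ⟨r, hr⟩ := mem_denominatorIdeal.1 (hd one_ne_zero)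
  have h1 : (expand R 2 q - X).coeff 1 = -1 := by
    rw [coeff_sub, coeff_expand two_pos, if_neg (by norm_num), coeff_X_one, zero_sub]
  rw [h1, map_neg, map_one] at hcd
  refine ⟨-d, c, -r, by rw [neg_smul, ← hr, map_neg], ?_⟩
  rw [map_sub, map_one, map_neg]
  linear_combination hcd

/-- An extension with the descending chain condition is Prüfer over an integrally closed
subring. -/
theorem isPruferElt_of_wellFoundedLT [WellFoundedLT (Subalgebra R S)] (B : Subalgebra R S)
    (hic : ∀ y : S, IsIntegral B y → ∃ r, algebraMap B S r = y) (x : S) : IsPruferElt B x := by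
  -- The rings B[x^(2^k)] descend. Where they stop, y = x^(2^k) lies in B[y²], and the criterion
  -- then descends from this power to x.
  let a : ℕ → Subalgebra R S := fun k => (Algebra.adjoin B {x ^ 2 ^ k}).restrictScalars R
  obtain ⟨_, ⟨k, rfl⟩, hk⟩ :=
    (wellFounded_lt (α := Subalgebra R S)).has_min (Set.range a) ⟨_, 0, rfl⟩
  have hle : a (k + 1) ≤ a k := by
    have : Algebra.adjoin B {x ^ 2 ^ (k + 1)} ≤ Algebra.adjoin B {x ^ 2 ^ k} := by
      rw [Algebra.adjoin_le_iff, Set.singleton_subset_iff, pow_succ, pow_mul]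
      exact pow_mem (Algebra.self_mem_adjoin_singleton _ _) _
    exact this
  have heq : a (k + 1) = a k := hle.eq_of_not_lt (hk _ ⟨k + 1, rfl⟩)
  have hmem : x ^ 2 ^ k ∈ a (k + 1) := by
    rw [heq]; exact Algebra.self_mem_adjoin_singleton B (x ^ 2 ^ k)
  have hy : IsPruferElt B (x ^ 2 ^ k) := by
    refine isPruferElt_of_mem_adjoin_sq hic ?_
    rw [← pow_mul, ← pow_succ]; exact hmem
  refine isPruferElt_of_forall_isMaximal fun m hm => ?_
  obtain ⟨n, hn⟩ := Nat.exists_eq_succ_of_ne_zero (pow_ne_zero k two_ne_zero)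
  rw [hn] at hy
  exact isPruferEltAt_of_pow hic (hy.isPruferEltAt hm.ne_top)

/-- Nakayama for the image of `N` in S/R, which is equal to its multiple by `m`. -/
theorem exists_smul_eq_of_fg_of_le {m : Ideal R} (hm : m ≠ ⊤) {N : Submodule R S} (hN : N.FG)
    (hle : N ≤ 1 ⊔ m • N) : ∃ t ∉ m, ∀ x ∈ N, t • x ∈ (1 : Submodule R S) := by
  obtain ⟨t, ht, h⟩ := Submodule.exists_sub_one_mem_and_smul_eq_zero_of_fg_of_le_smul m
    (N.map (1 : Submodule R S).mkQ) (hN.map _) (by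
      rw [← Submodule.map_smul'']
      refine (Submodule.map_mono hle).trans ?_
      rw [Submodule.map_sup, Submodule.mkQ_map_self, bot_sup_eq])
  refine ⟨t, fun h' => hm ((Ideal.eq_top_iff_one _).2 (by simpa using sub_mem h' ht)), ?_⟩
  intro x hx
  rw [← Submodule.Quotient.mk_eq_zero]
  exact h _ (Submodule.mem_map_of_mem hx)

theorem mem_localSaturation_bot {m : Ideal R} [m.IsPrime] {x : S} :
    x ∈ localSaturation (⊥ : Subalgebra R S) m ↔
      ∃ t ∉ m, ∃ r, t • x = algebraMap R S r := by
  simp only [mem_localSaturation, Algebra.mem_bot, Set.mem_range, eq_comm]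

/-- Take a minimal integral B not locally inside R; each of its elements that is not locally in R
generates it. If some a b with a in m were such an element, then B = R[a b] ⊆ R + m B, and Nakayama
would put B locally in R. -/
theorem exists_isIntegral_notMem_localSaturation [WellFoundedLT (Subalgebra R S)] (m : Ideal R)
    [hm : m.IsMaximal] (h : ¬ integralClosure R S ≤ localSaturation ⊥ m) :
    ∃ x : S, IsIntegral R x ∧ x ∉ localSaturation (⊥ : Subalgebra R S) m ∧
      ∀ a ∈ m, a • x ∈ localSaturation (⊥ : Subalgebra R S) m := by
  obtain ⟨B, ⟨hB, hBm⟩, hmin⟩ := (wellFounded_lt (α := Subalgebra R S)).has_min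
    {B | B ≤ integralClosure R S ∧ ¬ B ≤ localSaturation ⊥ m} ⟨_, le_rfl, h⟩
  obtain ⟨b, hb, hbm⟩ := SetLike.not_le_iff_exists.1 hBm
  have hadj : ∀ c ∈ B, c ∉ localSaturation (⊥ : Subalgebra R S) m → Algebra.adjoin R {c} = B := by
    intro c hc hcm
    have hle : Algebra.adjoin R {c} ≤ B := by simpa [Algebra.adjoin_le_iff] using hc
    refine hle.eq_of_not_lt (hmin _ ⟨hle.trans hB, fun hle' => hcm (hle' ?_)⟩)
    exact Algebra.self_mem_adjoin_singleton R c
  refine ⟨b, hB hb, hbm, ?_⟩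
  by_contra! hex
  obtain ⟨a, ha, hab⟩ := hex
  have hfg : (Subalgebra.toSubmodule B).FG := by
    rw [← hadj b hb hbm]; exact (hB hb).fg_adjoin_singleton
  obtain ⟨t, ht, hN⟩ := exists_smul_eq_of_fg_of_le hm.ne_top hfg (by
    intro c hc
    have hc' : c ∈ Algebra.adjoin R {a • b} := by rw [hadj _ (B.smul_mem hb a) hab]; exact hc
    rw [Algebra.adjoin_singleton_eq_range_aeval] at hc'
    obtain ⟨q, rfl⟩ := hc'
    have e : aeval (a • b) q = algebraMap R S (q.coeff 0) + a • (aeval (a • b) q.divX * b) := by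
      conv_lhs => rw [← divX_mul_X_add q]
      rw [map_add, map_mul, aeval_X, aeval_C, mul_smul_comm, add_comm]
    change aeval (a • b) q ∈ _
    rw [e]
    refine add_mem (Submodule.mem_sup_left (Submodule.mem_one.2 ⟨_, rfl⟩))
      (Submodule.mem_sup_right (Submodule.smul_mem_smul ha ?_))
    refine mul_mem (S := Subalgebra R S) ?_ hb
    exact hadj _ (B.smul_mem hb a) hab ▸ aeval_mem_adjoin_singleton R _)
  obtain ⟨r, hr⟩ := Submodule.mem_one.1 (hN b hb)
  exact hbm (mem_localSaturation_bot.2 ⟨t, ht, r, hr.symm⟩)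

/-- Gauss's lemma for a polynomial `g` of unit content locally at `m`. -/
theorem coeff_mem_localSaturation_of_map_mul_eq (m : Ideal R) [hm : m.IsMaximal] {g h : R[X]}
    {f : S[X]} (hg : ∃ i, g.coeff i ∉ m)
    (hf : g.map (algebraMap R S) * f = h.map (algebraMap R S)) (j : ℕ) :
    f.coeff j ∈ localSaturation (⊥ : Subalgebra R S) m := by
  classical
  -- In the coefficient of index i + j of g f, the terms with k < i lie in m N, and those with k > i
  -- involve earlier coefficients of f. This isolates g_i f_j, and g_i is invertible modulo m.
  obtain ⟨i, hi, hlt⟩ : ∃ i, g.coeff i ∉ m ∧ ∀ k < i, g.coeff k ∈ m :=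
    ⟨Nat.find hg, Nat.find_spec hg, fun k hk => not_not.1 (Nat.find_min hg hk)⟩
  set N : Submodule R S := Submodule.span R (f.coeffs : Set S) with hN
  have hfN : ∀ j, f.coeff j ∈ N := by
    intro j
    by_cases h0 : f.coeff j = 0
    · rw [h0]; exact zero_mem _
    · exact Submodule.subset_span (Finset.mem_coe.2 (coeff_mem_coeffs h0))
  have key : ∀ j, f.coeff j ∈ 1 ⊔ m • N := by
    intro j
    induction j using Nat.strong_induction_on with
    | _ j ih =>
      have h1 : g.coeff i • f.coeff j ∈ 1 ⊔ m • N := by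
        have hc := congrArg (fun q => q.coeff (i + j)) hf
        simp only [coeff_mul, coeff_map] at hc
        have hij : (i, j) ∈ Finset.HasAntidiagonal.antidiagonal (i + j) := by simp
        rw [← Finset.add_sum_erase _ _ hij, ← eq_sub_iff_add_eq, ← Algebra.smul_def] at hc
        rw [hc]
        refine sub_mem (Submodule.mem_sup_left (Submodule.mem_one.2 ⟨_, rfl⟩)) (sum_mem ?_)
        rintro ⟨k, l⟩ hkl
        rw [Finset.mem_erase, Finset.HasAntidiagonal.mem_antidiagonal, ne_eq, Prod.mk.injEq] at hkl
        rw [← Algebra.smul_def]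
        rcases lt_or_ge k i with hk | hk
        · exact Submodule.mem_sup_right (Submodule.smul_mem_smul (hlt k hk) (hfN l))
        · exact Submodule.smul_mem _ _ (ih l (by omega))
      obtain ⟨b, c, hc, hbc⟩ := hm.exists_inv hi
      rw [← one_smul R (f.coeff j), ← hbc, add_smul, mul_smul]
      exact add_mem (Submodule.smul_mem _ _ h1)
        (Submodule.mem_sup_right (Submodule.smul_mem_smul hc (hfN j)))
  obtain ⟨t, ht, h1⟩ := exists_smul_eq_of_fg_of_le hm.ne_top ⟨f.coeffs, rfl⟩ (by
    rw [Submodule.span_le]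
    intro c hc
    obtain ⟨n, -, rfl⟩ := mem_coeffs_iff.1 (Finset.mem_coe.1 hc)
    exact key n)
  obtain ⟨r, hr⟩ := Submodule.mem_one.1 (h1 _ (hfN j))
  exact mem_localSaturation_bot.2 ⟨t, ht, r, hr.symm⟩

end FCP

/-! ### Localization at m(X), and Prüfer extensions of R(X) at a bad m. -/

section NagataLocal

variable {R : Type*} [CommRing R]

/-- The extension `m(X)` of the ideal `m` to `R(X)`. -/
noncomputable def nagataIdeal (m : Ideal R) : Ideal (Nagata R) :=
  (m.map (C : R →+* R[X])).map (algebraMap R[X] (Nagata R))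

theorem disjoint_nagataSubmonoid {m : Ideal R} (hm : m ≠ ⊤) :
    Disjoint (nagataSubmonoid R : Set R[X]) (m.map (C : R →+* R[X]) : Set R[X]) := by
  rw [Set.disjoint_left]
  intro p hp hpm
  obtain ⟨i, hi⟩ := exists_coeff_notMem_of_mem_nagataSubmonoid hp hm
  exact hi (Ideal.mem_map_C_iff.1 hpm i)

instance nagataIdeal_isPrime (m : Ideal R) [hm : m.IsPrime] : (nagataIdeal m).IsPrime :=
  IsLocalization.isPrime_of_isPrime_disjoint (nagataSubmonoid R) _ _ Ideal.isPrime_map_C_of_isPrime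
    (disjoint_nagataSubmonoid hm.ne_top)

theorem algebraMap_mem_nagataIdeal_iff {m : Ideal R} [hm : m.IsPrime] {p : R[X]} :
    algebraMap R[X] (Nagata R) p ∈ nagataIdeal m ↔ ∀ i, p.coeff i ∈ m := by
  rw [← Ideal.mem_map_C_iff, ← Ideal.mem_under, nagataIdeal,
    IsLocalization.under_map_of_isPrime_disjoint (nagataSubmonoid R) (Nagata R)
      Ideal.isPrime_map_C_of_isPrime (disjoint_nagataSubmonoid hm.ne_top)]

variable {S : Type*} [CommRing S] [Algebra R S]

theorem coeff_mem_localSaturation_of_mem_nagata (m : Ideal R) [hm : m.IsMaximal]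
    {f : S[X]} (hf : algebraMap S[X] (Nagata S) f ∈
      localSaturation (⊥ : Subalgebra (Nagata R) (Nagata S)) (nagataIdeal m)) (j : ℕ) :
    f.coeff j ∈ localSaturation (⊥ : Subalgebra R S) m := by
  obtain ⟨t, ht, r, hr⟩ := mem_localSaturation_bot.1 hf
  obtain ⟨⟨p, c⟩, hp⟩ := IsLocalization.surj (nagataSubmonoid R) t
  obtain ⟨⟨q, d⟩, hq⟩ := IsLocalization.surj (nagataSubmonoid R) r
  have hunit : ∀ c : nagataSubmonoid R, algebraMap R[X] (Nagata R) c ∉ nagataIdeal m := by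
    intro c hc
    obtain ⟨i, hi⟩ := exists_coeff_notMem_of_mem_nagataSubmonoid c.2 hm.ne_top
    exact hi (algebraMap_mem_nagataIdeal_iff.1 hc i)
  have hg : algebraMap R[X] (Nagata R) (p * d) ∉ nagataIdeal m := by
    rw [map_mul, ← hp]
    exact (nagataIdeal m).primeCompl.mul_mem
      ((nagataIdeal m).primeCompl.mul_mem ht (hunit c)) (hunit d)
  rw [algebraMap_mem_nagataIdeal_iff, not_forall] at hg
  refine coeff_mem_localSaturation_of_map_mul_eq m (h := q * c) hg
    (algebraMap_nagata_injective S ?_) j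
  rw [map_mul, ← algebraMap_nagata, ← algebraMap_nagata, map_mul, map_mul, map_mul, map_mul, ← hp,
    ← hq, map_mul, map_mul]
  rw [Algebra.smul_def] at hr
  rw [← hr]; ring

theorem le_localSaturation_nagataIdeal (hinj : Function.Injective (algebraMap R S))
    {U : Subalgebra (Nagata R) (Nagata S)} (hU : IsPruferExtension (Nagata R) U) (m : Ideal R)
    [hm : m.IsMaximal] {x : S} (hx : IsIntegral R x)
    (hxm : x ∉ localSaturation (⊥ : Subalgebra R S) m)
    (hmx : ∀ a ∈ m, a • x ∈ localSaturation (⊥ : Subalgebra R S) m) :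
    U ≤ localSaturation ⊥ (nagataIdeal m) := by
  have hinj' := nagataMap_injective R S hinj
  intro u hu
  obtain h | ⟨r, t, ht, hrt⟩ := isPruferEltAt_iff.1
    (((isPruferExtension_subalgebra_iff hinj' U).1 hU u hu).isPruferEltAt
      (nagataIdeal_isPrime m).ne_top)
  · exact h
  by_cases hr : r ∉ nagataIdeal m
  · exact mem_localSaturation_bot.2 ⟨r, hr, t, hrt⟩
  exfalso
  set y : Nagata S := algebraMap S[X] (Nagata S) (C x) with hy
  have hle : nagataIdeal m ≤ (Subalgebra.toSubmodule (localSaturation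
      (⊥ : Subalgebra (Nagata R) (Nagata S)) (nagataIdeal m))).comap
        (LinearMap.toSpanSingleton (Nagata R) (Nagata S) y) := by
    refine (Ideal.map_map _ _).le.trans (Ideal.map_le_iff_le_comap.2 fun a ha => ?_)
    obtain ⟨t, ht, r, htr⟩ := mem_localSaturation_bot.1 (hmx a ha)
    refine mem_localSaturation_bot.2 ⟨algebraMap R[X] (Nagata R) (C t), ?_,
      algebraMap R[X] (Nagata R) (C r), ?_⟩
    · rw [algebraMap_mem_nagataIdeal_iff, not_forall]
      exact ⟨0, by rwa [coeff_C_zero]⟩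
    · rw [LinearMap.toSpanSingleton_apply, RingHom.comp_apply, Algebra.smul_def, Algebra.smul_def,
        algebraMap_nagata, algebraMap_nagata, algebraMap_nagata, hy, ← map_mul, ← map_mul, map_C,
        map_C, map_C, ← C_mul, ← C_mul, ← htr, Algebra.smul_def, Algebra.smul_def]
  obtain ⟨s, hs, z, hz⟩ := mem_localSaturation_bot.1 (hle (not_not.1 hr))
  rw [LinearMap.toSpanSingleton_apply] at hz
  -- With r u = t and s r y = z in R(X), we get s t y = u z in U. This element is integral, so it
  -- lies in R(X), and y lies locally in R(X), contrary to the choice of x.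
  have hmem : (s * t) • y ∈ U := by
    have : (s * t) • y = u * algebraMap (Nagata R) (Nagata S) z := by
      rw [← hz, Algebra.smul_def, map_mul, ← hrt]
      simp only [Algebra.smul_def]; ring
    rw [this]
    exact mul_mem hu (U.algebraMap_mem z)
  have hyint : IsIntegral (Nagata R) y :=
    IsIntegral.map_of_comp_eq ((algebraMap R[X] (Nagata R)).comp C)
      ((algebraMap S[X] (Nagata S)).comp C)
      (by ext a; simp only [RingHom.comp_apply]; rw [algebraMap_nagata, map_C]) hx
  have hint : IsIntegral (Nagata R) (⟨(s * t) • y, hmem⟩ : U) :=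
    (isIntegral_algHom_iff U.val Subtype.val_injective).1 <| by
      change IsIntegral (Nagata R) ((s * t) • y)
      rw [Algebra.smul_def]; exact isIntegral_algebraMap.mul hyint
  obtain ⟨w, hw⟩ := hU.mem_range_of_isIntegral
    (fun a b hab => hinj' (congrArg Subtype.val hab)) hint
  have hy' : y ∈ localSaturation (⊥ : Subalgebra (Nagata R) (Nagata S)) (nagataIdeal m) :=
    mem_localSaturation_bot.2 ⟨s * t, (nagataIdeal m).primeCompl.mul_mem hs ht, w,
      (congrArg Subtype.val hw).symm⟩
  have := coeff_mem_localSaturation_of_mem_nagata m hy' 0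
  rw [coeff_C_zero] at this
  exact hxm this

end NagataLocal

/-! ### The ring H and the comparison of the hulls. -/

section Hull

variable (R S : Type*) [CommRing R] [CommRing S] [Algebra R S]

/-- The elements of `S` that lie in `R` locally at every maximal ideal where `R` is not integrally
closed in `S`. -/
def integrallyClosedHull : Subalgebra R S :=
  sInf {V | ∃ (m : Ideal R) (_ : m.IsMaximal), ¬ integralClosure R S ≤ localSaturation ⊥ m ∧
    V = localSaturation ⊥ m}

variable {R S}

theorem mem_integrallyClosedHull {x : S} : x ∈ integrallyClosedHull R S ↔
    ∀ (m : Ideal R) (_ : m.IsMaximal), ¬ integralClosure R S ≤ localSaturation ⊥ m →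
      x ∈ localSaturation (⊥ : Subalgebra R S) m := by
  rw [integrallyClosedHull, Algebra.mem_sInf]
  exact ⟨fun h m hm hb => h _ ⟨m, hm, hb, rfl⟩, by rintro h _ ⟨m, hm, hb, rfl⟩; exact h m hm hb⟩

theorem isPruferEltAt_of_le_localSaturation {B : Subalgebra R S} {m : Ideal R} [hm : m.IsPrime]
    (hB : B ≤ localSaturation ⊥ m) {x : S} (hx : IsPruferElt B x) : IsPruferEltAt m x := by
  obtain ⟨a, b, r, h1, h2⟩ := hx
  obtain ⟨s₁, hs₁, a', ha⟩ := mem_localSaturation_bot.1 (hB a.2)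
  obtain ⟨s₂, hs₂, b', hb⟩ := mem_localSaturation_bot.1 (hB b.2)
  obtain ⟨s₃, hs₃, r', hr⟩ := mem_localSaturation_bot.1 (hB r.2)
  have h1' : (a : S) * x = r := h1
  have h2' : (b : S) * x = 1 - a := h2
  rw [Algebra.smul_def] at ha hb hr
  have hs := m.primeCompl.mul_mem (m.primeCompl.mul_mem hs₁ hs₂) hs₃
  -- This is `a` times the common denominator s₁ s₂ s₃. If it lies in m, then the numerator of 1 - a
  -- does not.
  by_cases ham : s₂ * s₃ * a' ∈ m
  · refine Or.inr ⟨s₁ * s₃ * b', s₁ * s₂ * s₃ - s₂ * s₃ * a', fun h => hs ?_, ?_⟩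
    · simpa using add_mem h ham
    · rw [Algebra.smul_def]
      simp only [map_sub, map_mul]
      rw [← ha, ← hb]
      linear_combination (algebraMap R S s₁ * algebraMap R S s₂ * algebraMap R S s₃) * h2'
  · refine Or.inl ⟨s₂ * s₃ * a', ham, s₁ * s₂ * r', ?_⟩
    rw [Algebra.smul_def]
    simp only [map_mul]
    rw [← ha, ← hr]
    linear_combination (algebraMap R S s₁ * algebraMap R S s₂ * algebraMap R S s₃) * h1'

theorem isPruferElt_integralClosure [WellFoundedLT (Subalgebra R S)] (x : S) :
    IsPruferElt (integralClosure R S) x :=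
  isPruferElt_of_wellFoundedLT _
    (fun y hy => ⟨⟨y, isIntegral_trans (R := R) y hy⟩, rfl⟩) x

/-- At a bad m the elements lie locally in R. At any other m the integral closure agrees locally
with R, and S is Prüfer over it. -/
theorem isPruferExtension_integrallyClosedHull (hinj : Function.Injective (algebraMap R S))
    [WellFoundedLT (Subalgebra R S)] : IsPruferExtension R (integrallyClosedHull R S) := by
  rw [isPruferExtension_subalgebra_iff hinj]
  intro x hx
  refine isPruferElt_of_forall_isMaximal fun m hm => ?_
  by_cases hb : integralClosure R S ≤ localSaturation ⊥ m
  · exact isPruferEltAt_of_le_localSaturation hb (isPruferElt_integralClosure x)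
  · exact isPruferEltAt_iff.2 (Or.inl (mem_integrallyClosedHull.1 hx m hm hb))

theorem hasNagataDenominators_of_wellFoundedLT [WellFoundedLT (Subalgebra R S)] :
    HasNagataDenominators R S :=
  (hasNagataDenominators_of_isIntegral (R := R) (S := integralClosure R S)).trans
    (hasNagataDenominators_of_forall_isPruferElt Subtype.val_injective isPruferElt_integralClosure)

theorem le_nagataSubalgebra_integrallyClosedHull (hinj : Function.Injective (algebraMap R S))
    [WellFoundedLT (Subalgebra R S)] {U : Subalgebra (Nagata R) (Nagata S)}
    (hU : IsPruferExtension (Nagata R) U) : U ≤ nagataSubalgebra (integrallyClosedHull R S) := by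
  intro u hu
  obtain ⟨f, s, rfl⟩ := IsLocalization.exists_mk'_eq (nagataSubmonoid S) u
  obtain ⟨p, hp, g, hg⟩ := hasNagataDenominators_of_wellFoundedLT (R := R) s.1 s.2
  have hpu : algebraMap R[X] (Nagata R) p • IsLocalization.mk' (Nagata S) f s =
      algebraMap S[X] (Nagata S) (g * f) := by
    rw [Algebra.smul_def, algebraMap_nagata, hg, mul_comm (s : S[X]), map_mul, mul_assoc,
      IsLocalization.mk'_spec', map_mul]
  have hmem : algebraMap S[X] (Nagata S) (g * f) ∈ U := hpu ▸ U.smul_mem hu _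
  have hcoeff : ∀ i, (g * f).coeff i ∈ integrallyClosedHull R S := by
    refine fun i => mem_integrallyClosedHull.2 fun m hm hb => ?_
    obtain ⟨x, hx, hxm, hmx⟩ := exists_isIntegral_notMem_localSaturation m hb
    exact coeff_mem_localSaturation_of_mem_nagata m
      (le_localSaturation_nagataIdeal hinj hU m hx hxm hmx hmem) i
  obtain ⟨q, hq⟩ := exists_map_eq_of_forall_coeff (R := integrallyClosedHull R S)
    (f := g * f) fun i => ⟨⟨_, hcoeff i⟩, rfl⟩
  -- `p` is a unit of R(X), so it can be divided out again inside H(X).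
  obtain ⟨v, hv⟩ := IsLocalization.map_units (Nagata R) (⟨p, hp⟩ : nagataSubmonoid R)
  have hq' : algebraMap S[X] (Nagata S) (g * f) ∈
      nagataSubalgebra (integrallyClosedHull R S) := by
    rw [← hq]
    exact ⟨algebraMap _ _ q, algebraMap_nagata (R := integrallyClosedHull R S) q⟩
  rw [← hpu, ← show (v : Nagata R) = algebraMap R[X] (Nagata R) p from hv] at hq'
  have := Subalgebra.smul_mem _ hq' (↑v⁻¹ : Nagata R)
  rwa [Algebra.smul_def, Algebra.smul_def, ← mul_assoc, ← map_mul, Units.inv_mul, map_one,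
    one_mul] at this

theorem nagataSubalgebra_mono {T T' : Subalgebra R S} (h : T ≤ T') :
    nagataSubalgebra T ≤ nagataSubalgebra T' := by
  let := (Subalgebra.inclusion h).toAlgebra
  have : IsScalarTower T T' S := IsScalarTower.of_algebraMap_eq fun _ => rfl
  rintro _ ⟨y, rfl⟩
  exact ⟨nagataMap T T' y, RingHom.congr_fun (nagataMap_comp T T' S) y⟩

end Hull

theorem mainTheorem10 {R S : Type*} [CommRing R] [CommRing S] [Algebra R S]
    (hRS : Function.Injective (algebraMap R S)) (hFCP : HasFCP R S) :
    IsPruferHull R S (pruferHull R S) ∧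
    IsPruferHull (Nagata R) (Nagata S) (pruferHull (Nagata R) (Nagata S)) ∧
    pruferHull (Nagata R) (Nagata S) = nagataSubalgebra (pruferHull R S) := by
  have := hFCP.wellFoundedLT
  have h1 := isPruferHull_pruferHull hRS
  have h2 := isPruferHull_pruferHull (nagataMap_injective R S hRS)
  refine ⟨h1, h2, le_antisymm ?_ (h2.2 (isPruferExtension_nagataSubalgebra hRS h1.1))⟩
  exact (le_nagataSubalgebra_integrallyClosedHull hRS h2.1).trans
    (nagataSubalgebra_mono (h1.2 (isPruferExtension_integrallyClosedHull hRS)))
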